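/- Let $n\ge 0$ be an integer and let $S\subseteq[n-1]=\{1,2,\dots,n-1\}$ (with $[n-1]=\emptyset$ for $n\le 1$). A permutation $\pi$ of $[n]=\{1,\dots,n\}$ is $321$-avoiding if there are no $i<j<k$ with $\pi(i)>\pi(j)>\pi(k)$; $\mathcal S_n(321)$ denotes the set of $321$-avoiding permutations of $[n]$, and $\mathrm{Des}(\pi)=\{i : 1\le i<n,\ \pi(i)>\pi(i+1)\}$ is the descent set of $\pi$. Let $C_m=\frac{1}{m+1}\binom{2m}{m}$ be the $m$-th Catalan number. Then $$|\{\pi\in\mathcal S_n(321):\mathrm{Des}(\pi)\supseteq S\}|=\begin{cases} C_{n-|S|} & \text{if } S \text{ contains no two consecutive elements (that is, no } i \text{ with } i,\,i+1\in S\text{)},\\ 0 & \text{otherwise.}\end{cases}$$ -/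

import Mathlib

/-- A permutation `π` of `[n]`, as a permutation of `Fin n`, avoids `321` if there are no positions
`i < j < k` with `π i > π j > π k`. -/
def Avoids321 {n : ℕ} (π : Equiv.Perm (Fin n)) : Prop :=
  ¬ ∃ i j k : Fin n, i < j ∧ j < k ∧ π i > π j ∧ π j > π k

/-- The descent set of a permutation of `[n]`, as a subset of `{1, …, n - 1}`: the positions `i`,
`1 ≤ i < n`, at which the `i`-th entry exceeds the next one. The element `m : Fin n` stands for
`m + 1 ∈ [n]`, so the `i`-th entry is the value of `π` at `i - 1 : Fin n`. -/
def descentSet {n : ℕ} (π : Equiv.Perm (Fin n)) : Set ℕ :=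
  {i | ∃ h : 1 ≤ i ∧ i < n, π ⟨i - 1, by omega⟩ > π ⟨i, h.2⟩}

open Finset

/-! Build permutations by appending last entries. With `b = inversionBound σ`, a `321`-avoider `σ`
of `[n]` extends exactly by the values `v` with `b ≤ v ≤ n`. Put `d = n - b`: there are `d + 1`
extensions, and their own parameters are `1, …, d + 1`, which is the Catalan tree. Appending two
entries with a forced descent between them makes the first one maximal, and the resulting parameters
are again `1, …, d + 1`. So a descent pair costs one tree step instead of two, leaving `n - |S|`
steps from the root `d = 0`. -/

/-! ### Ballot numbers -/

/-- The number of ways to make `m` steps in the Catalan generating tree, starting from a node with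
`d + 1` children. -/
def catalanTreeCount : ℕ → ℕ → ℕ
  | 0, _ => 1
  | m + 1, d => ∑ t ∈ range (d + 1), catalanTreeCount m (t + 1)

/-- Splitting off the last child gives a recurrence in `d` that matches Pascal's rule. The additive
form avoids truncated subtraction. -/
theorem catalanTreeCount_add_choose (m d : ℕ) :
    catalanTreeCount (m + 1) d + (2 * m + 2 + d).choose m = (2 * m + 2 + d).choose (m + 1) := by
  induction m generalizing d with
  | zero => simp [catalanTreeCount]; omega
  | succ m ih =>
    have hsum : ∀ d, catalanTreeCount (m + 2) (d + 1) =
        catalanTreeCount (m + 2) d + catalanTreeCount (m + 1) (d + 2) := fun d =>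
      sum_range_succ (fun t => catalanTreeCount (m + 1) (t + 1)) (d + 1)
    induction d with
    | zero =>
      have h0 : catalanTreeCount (m + 2) 0 = catalanTreeCount (m + 1) 1 := by
        rw [catalanTreeCount]; simp
      have h1 := ih 1
      have e : 2 * (m + 1) + 2 + 0 = (2 * m + 3) + 1 := by ring
      have e' : 2 * m + 2 + 1 = 2 * m + 3 := by ring
      -- The two middle binomials of an odd row agree; this settles the boundary `d = 0`.
      have hs : (2 * m + 3).choose (m + 2) = (2 * m + 3).choose (m + 1) :=
        Nat.choose_symm_of_eq_add (by ring)
      rw [e'] at h1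
      rw [h0, e, Nat.choose_succ_succ, Nat.choose_succ_succ (2 * m + 3) (m + 1)]
      simp only [Nat.succ_eq_add_one, add_assoc, Nat.reduceAdd] at *
      omega
    | succ d ihd =>
      have h1 := ih (d + 2)
      have e : 2 * (m + 1) + 2 + (d + 1) = (2 * m + d + 4) + 1 := by ring
      have e' : 2 * m + 2 + (d + 2) = 2 * m + d + 4 := by ring
      have e'' : 2 * (m + 1) + 2 + d = 2 * m + d + 4 := by ring
      rw [e'] at h1
      rw [e''] at ihd
      rw [hsum, e, Nat.choose_succ_succ, Nat.choose_succ_succ (2 * m + d + 4) (m + 1)]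
      simp only [Nat.succ_eq_add_one, add_assoc, Nat.reduceAdd] at *
      omega

theorem catalanTreeCount_zero_right (m : ℕ) : catalanTreeCount m 0 = catalan m := by
  cases m with
  | zero => simp [catalanTreeCount]
  | succ m =>
    have h := catalanTreeCount_add_choose m 0
    have h1 := succ_mul_catalan_eq_centralBinom (m + 1)
    have h2 := Nat.choose_succ_right_eq (2 * m + 2) m
    rw [Nat.centralBinom_eq_two_mul_choose] at h1
    have e : 2 * (m + 1) = 2 * m + 2 := by ring
    have e' : 2 * m + 2 - m = m + 2 := by omega
    rw [e] at h1
    rw [e'] at h2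
    simp only [add_zero] at h
    have : (m + 2) * catalanTreeCount (m + 1) 0 = (m + 2) * catalan (m + 1) := by
      nlinarith
    exact Nat.eq_of_mul_eq_mul_left (by omega) this

/-! ### Appending a last entry to a permutation -/

/-- The permutation of `n + 1` letters with last entry `v` whose other entries are in the same
relative order as those of `σ`. -/
def snocPerm {n : ℕ} (σ : Equiv.Perm (Fin n)) (v : Fin (n + 1)) : Equiv.Perm (Fin (n + 1)) :=
  finSuccEquivLast.trans ((Equiv.optionCongr σ).trans (finSuccEquiv' v).symm)

@[simp] theorem snocPerm_castSucc {n : ℕ} (σ : Equiv.Perm (Fin n)) (v : Fin (n + 1)) (i : Fin n) :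
    snocPerm σ v i.castSucc = v.succAbove (σ i) := by
  simp [snocPerm]

@[simp] theorem snocPerm_last {n : ℕ} (σ : Equiv.Perm (Fin n)) (v : Fin (n + 1)) :
    snocPerm σ v (Fin.last n) = v := by
  simp [snocPerm]

theorem snocPerm_bijective (n : ℕ) :
    Function.Bijective fun p : Equiv.Perm (Fin n) × Fin (n + 1) => snocPerm p.1 p.2 := by
  rw [Fintype.bijective_iff_injective_and_card]
  constructor
  · rintro ⟨σ, v⟩ ⟨τ, w⟩ h
    have hvw : v = w := by simpa using Equiv.congr_fun h (Fin.last n)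
    subst hvw
    congr 1
    ext i : 1
    simpa using Equiv.congr_fun h i.castSucc
  · simp [Fintype.card_perm, Nat.factorial_succ, mul_comm]

theorem sum_perm_succ {n : ℕ} (f : Equiv.Perm (Fin (n + 1)) → ℕ) :
    ∑ π, f π = ∑ σ : Equiv.Perm (Fin n), ∑ v, f (snocPerm σ v) := by
  rw [← Fintype.sum_prod_type' fun σ v => f (snocPerm σ v)]
  exact (Fintype.sum_bijective _ (snocPerm_bijective n) _ _ fun _ => rfl).symm

/-- One more than the largest value of `π` (values being counted from `0`) that is preceded by a
larger one; `0` if there is none. -/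
def inversionBound {n : ℕ} (π : Equiv.Perm (Fin n)) : ℕ :=
  (univ.filter fun j => ∃ i < j, π j < π i).sup fun j => (π j : ℕ) + 1

theorem inversionBound_le_iff {n : ℕ} {π : Equiv.Perm (Fin n)} {c : ℕ} :
    inversionBound π ≤ c ↔ ∀ i j, i < j → π j < π i → (π j : ℕ) < c := by
  simp only [inversionBound, Finset.sup_le_iff, mem_filter, mem_univ, true_and]
  constructor
  · exact fun h i j hij hp => h j ⟨i, hij, hp⟩
  · rintro h j ⟨i, hij, hp⟩
    exact h i j hij hp

theorem inversionBound_le {n : ℕ} (π : Equiv.Perm (Fin n)) : inversionBound π ≤ n :=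
  inversionBound_le_iff.2 fun _ j _ _ => (π j).2

/-- A new `321` must end at the appended entry, below the lower value of an inversion of `σ`. -/
theorem avoids321_snocPerm {n : ℕ} {σ : Equiv.Perm (Fin n)} {v : Fin (n + 1)} :
    Avoids321 (snocPerm σ v) ↔ Avoids321 σ ∧ inversionBound σ ≤ v := by
  rw [inversionBound_le_iff]
  constructor
  · intro h
    refine ⟨?_, fun i j hij hp => ?_⟩
    · rintro ⟨i, j, k, hij, hjk, h1, h2⟩
      exact h ⟨i.castSucc, j.castSucc, k.castSucc, by simpa, by simpa,
        by simpa using h1, by simpa using h2⟩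
    · by_contra hlt
      refine h ⟨i.castSucc, j.castSucc, Fin.last n, by simpa, Fin.castSucc_lt_last j,
        by simpa using hp, ?_⟩
      simp only [snocPerm_castSucc, snocPerm_last, gt_iff_lt, Fin.lt_succAbove_iff_le_castSucc,
        Fin.le_def, Fin.val_castSucc]
      omega
  · rintro ⟨h, hb⟩ ⟨i, j, k, hij, hjk, h1, h2⟩
    induction j using Fin.lastCases with
    | last => exact absurd hjk (Fin.le_last k).not_gt
    | cast j =>
      induction i using Fin.lastCases with
      | last => exact absurd hij (Fin.le_last _).not_gt
      | cast i =>
        simp only [snocPerm_castSucc, gt_iff_lt, Fin.succAbove_lt_succAbove_iff] at h1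
        induction k using Fin.lastCases with
        | last =>
          have := hb i j (by simpa using hij) h1
          simp only [snocPerm_castSucc, snocPerm_last, gt_iff_lt,
            Fin.lt_succAbove_iff_le_castSucc, Fin.le_def, Fin.val_castSucc] at h2
          omega
        | cast k =>
          exact h ⟨i, j, k, by simpa using hij, by simpa using hjk, h1, by simpa using h2⟩

theorem inversionBound_snocPerm_last {n : ℕ} (σ : Equiv.Perm (Fin n)) :
    inversionBound (snocPerm σ (Fin.last n)) = inversionBound σ := by
  refine eq_of_forall_ge_iff fun c => ?_
  simp only [inversionBound_le_iff]
  constructor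
  · intro h i j hij hp
    simpa using h i.castSucc j.castSucc (by simpa) (by simpa using hp)
  · intro h i j hij hp
    induction j using Fin.lastCases with
    | last => exact absurd hp (by simpa using Fin.le_last _)
    | cast j =>
      induction i using Fin.lastCases with
      | last => exact absurd hij (Fin.le_last _).not_gt
      | cast i => simpa using h i j (by simpa using hij) (by simpa using hp)

theorem inversionBound_snocPerm_castSucc {n : ℕ} {σ : Equiv.Perm (Fin n)} {v : Fin n}
    (hv : inversionBound σ ≤ v) : inversionBound (snocPerm σ v.castSucc) = v + 1 := by
  rw [inversionBound_le_iff] at hv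
  apply le_antisymm
  · rw [inversionBound_le_iff]
    intro i j hij hp
    induction j using Fin.lastCases with
    | last => simp
    | cast j =>
      induction i using Fin.lastCases with
      | last => exact absurd hij (Fin.le_last _).not_gt
      | cast i =>
        have hj := hv i j (by simpa using hij) (by simpa using hp)
        rw [snocPerm_castSucc, Fin.succAbove_of_castSucc_lt _ _ (Fin.castSucc_lt_castSucc_iff.2 hj)]
        simp only [Fin.val_castSucc]
        omega
  -- The old value `v` is raised to `v + 1`, so it forms an inversion with the last entry.
  · have := (inversionBound_le_iff (π := snocPerm σ v.castSucc)).1 le_rfl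
      (σ.symm v).castSucc (Fin.last n) (Fin.castSucc_lt_last _) (by simp)
    simpa using this

theorem mem_descentSet_snocPerm_of_lt {n i : ℕ} (hi : i < n) (σ : Equiv.Perm (Fin n))
    (v : Fin (n + 1)) : i ∈ descentSet (snocPerm σ v) ↔ i ∈ descentSet σ := by
  have key : ∀ (a b : Fin n), snocPerm σ v a.castSucc > snocPerm σ v b.castSucc ↔ σ a > σ b := by
    simp
  constructor
  · rintro ⟨h, hd⟩
    exact ⟨⟨h.1, hi⟩, (key ⟨i - 1, by omega⟩ ⟨i, hi⟩).1 hd⟩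
  · rintro ⟨h, hd⟩
    exact ⟨⟨h.1, by omega⟩, (key ⟨i - 1, by omega⟩ ⟨i, hi⟩).2 hd⟩

theorem subset_descentSet_snocPerm {n : ℕ} {S : Finset ℕ} (hS : S ⊆ Icc 1 (n - 1))
    (σ : Equiv.Perm (Fin n)) (v : Fin (n + 1)) :
    (S : Set ℕ) ⊆ descentSet (snocPerm σ v) ↔ (S : Set ℕ) ⊆ descentSet σ := by
  refine forall₂_congr fun i hi => mem_descentSet_snocPerm_of_lt ?_ σ v
  have := mem_Icc.1 (hS hi)
  omega

theorem mem_descentSet_snocPerm_snocPerm {n : ℕ} (τ : Equiv.Perm (Fin n)) (w : Fin (n + 1))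
    (v : Fin (n + 2)) :
    n + 1 ∈ descentSet (snocPerm (snocPerm τ w) v) ↔ v ≤ w.castSucc := by
  have key : snocPerm (snocPerm τ w) v (Fin.last n).castSucc >
      snocPerm (snocPerm τ w) v (Fin.last (n + 1)) ↔ v ≤ w.castSucc := by
    rw [snocPerm_castSucc, snocPerm_last, snocPerm_last, gt_iff_lt,
      Fin.lt_succAbove_iff_le_castSucc]
  rw [← key]
  exact ⟨fun ⟨_, hd⟩ => hd, fun hd => ⟨⟨by omega, by omega⟩, hd⟩⟩

/-- A non-maximal `w` raises the bound to `w + 1`, which forces `v > w` and rules out the descent; a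
maximal `w` leaves the bound unchanged. -/
theorem avoids321_and_descent_snocPerm_snocPerm {n : ℕ} {S : Finset ℕ} (hS : S ⊆ Icc 1 (n - 1))
    (τ : Equiv.Perm (Fin n)) (w : Fin (n + 1)) (v : Fin (n + 2)) :
    (Avoids321 (snocPerm (snocPerm τ w) v) ∧
      ((insert (n + 1) S : Finset ℕ) : Set ℕ) ⊆ descentSet (snocPerm (snocPerm τ w) v)) ↔
    (Avoids321 τ ∧ (S : Set ℕ) ⊆ descentSet τ) ∧ w = Fin.last n ∧ inversionBound τ ≤ v ∧
      v ≠ Fin.last (n + 1) := by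
  have hS' : S ⊆ Icc 1 (n + 1 - 1) := hS.trans (Icc_subset_Icc le_rfl (by omega))
  rw [coe_insert, Set.insert_subset_iff, mem_descentSet_snocPerm_snocPerm,
    subset_descentSet_snocPerm hS', subset_descentSet_snocPerm hS, avoids321_snocPerm,
    avoids321_snocPerm]
  have hlast := inversionBound_snocPerm_last τ
  constructor
  · rintro ⟨⟨⟨hτ, hw⟩, hv⟩, hvw, hd⟩
    have hwl : w = Fin.last n := by
      induction w using Fin.lastCases with
      | last => rfl
      | cast w =>
        rw [inversionBound_snocPerm_castSucc (by simpa using hw)] at hv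
        simp only [Fin.le_def, Fin.val_castSucc] at hvw
        omega
    subst hwl
    refine ⟨⟨hτ, hd⟩, rfl, hlast ▸ hv, ?_⟩
    rintro rfl
    simp [Fin.le_def] at hvw
  · rintro ⟨⟨hτ, hd⟩, rfl, hv, hne⟩
    refine ⟨⟨⟨hτ, inversionBound_le τ⟩, hlast.symm ▸ hv⟩, ?_, hd⟩
    have := Fin.val_lt_last hne
    simp only [Fin.le_def, Fin.val_castSucc, Fin.val_last]
    omega

/-! ### The weighted count -/

open Classical in
/-- The `321`-avoiding permutations with descents at `S`, each counted with the number of ways to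
make `m` more steps from it in the Catalan generating tree. -/
noncomputable def avoidingWeight (n : ℕ) (S : Finset ℕ) (m : ℕ) : ℕ :=
  ∑ π : Equiv.Perm (Fin n), if Avoids321 π ∧ (S : Set ℕ) ⊆ descentSet π then
    catalanTreeCount m (n - inversionBound π) else 0

theorem sum_fin_catalanTreeCount {n b : ℕ} (hb : b ≤ n) (m : ℕ) :
    (∑ v : Fin n, if b ≤ v then catalanTreeCount m (n - v) else 0) =
      ∑ t ∈ range (n - b), catalanTreeCount m (t + 1) := by
  rw [Fin.sum_univ_eq_sum_range (fun v => if b ≤ v then catalanTreeCount m (n - v) else 0),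
    ← sum_range_reflect, ← sum_subset (range_subset_range.2 (Nat.sub_le n b))]
  · refine sum_congr rfl fun t ht => ?_
    rw [mem_range] at ht
    rw [if_pos (by omega), show n - (n - 1 - t) = t + 1 by omega]
  · intro t ht ht'
    rw [mem_range] at ht ht'
    rw [if_neg (by omega)]

/-- A value `v < n` yields parameter `n - v`; the maximal value keeps the bound and yields the top
child. -/
theorem avoidingWeight_succ {n : ℕ} {S : Finset ℕ} (hS : S ⊆ Icc 1 (n - 1)) (m : ℕ) :
    avoidingWeight (n + 1) S m = avoidingWeight n S (m + 1) := by
  rw [avoidingWeight, sum_perm_succ, avoidingWeight]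
  refine sum_congr rfl fun σ _ => ?_
  classical
  simp only [avoids321_snocPerm, subset_descentSet_snocPerm hS]
  by_cases hσ : Avoids321 σ ∧ (S : Set ℕ) ⊆ descentSet σ
  · have hb := inversionBound_le σ
    simp only [hσ.1, hσ.2, true_and, and_true, if_true]
    rw [Fin.sum_univ_castSucc, Fin.val_last, if_pos hb, inversionBound_snocPerm_last,
      catalanTreeCount, sum_range_succ, ← sum_fin_catalanTreeCount hb, ← Nat.sub_add_comm hb]
    congr 1
    refine sum_congr rfl fun v _ => ?_
    rw [Fin.val_castSucc]
    split_ifs with h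
    · rw [inversionBound_snocPerm_castSucc h, Nat.add_sub_add_right]
    · rfl
  · rw [if_neg hσ]
    exact sum_eq_zero fun v _ => if_neg fun h => hσ ⟨h.1.1, h.2⟩

/-- The new parameters `n + 1 - v`, for `inversionBound τ ≤ v ≤ n`, are exactly those of the
children of `τ`. -/
theorem avoidingWeight_insert {n : ℕ} {S : Finset ℕ} (hS : S ⊆ Icc 1 (n - 1)) (m : ℕ) :
    avoidingWeight (n + 2) (insert (n + 1) S) m = avoidingWeight n S (m + 1) := by
  rw [avoidingWeight, sum_perm_succ, sum_perm_succ, avoidingWeight]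
  refine sum_congr rfl fun τ _ => ?_
  classical
  simp only [avoids321_and_descent_snocPerm_snocPerm hS]
  by_cases hτ : Avoids321 τ ∧ (S : Set ℕ) ⊆ descentSet τ
  · have hb := inversionBound_le τ
    rw [if_pos hτ, Fintype.sum_eq_single (Fin.last n) fun w hw =>
      sum_eq_zero fun v _ => if_neg fun h => hw h.2.1]
    rw [Fin.sum_univ_castSucc, if_neg fun h => h.2.2.2 rfl, add_zero, catalanTreeCount,
      ← Nat.sub_add_comm hb, ← sum_fin_catalanTreeCount (by omega)]
    refine sum_congr rfl fun v _ => ?_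
    simp only [hτ, true_and, Fin.val_castSucc, (Fin.castSucc_lt_last v).ne, ne_eq,
      not_false_eq_true, and_true]
    split_ifs with h
    · rw [inversionBound_snocPerm_castSucc (by rwa [inversionBound_snocPerm_last]),
        show n + 2 - ((v : ℕ) + 1) = n + 1 - v by omega]
    · rfl
  · rw [if_neg hτ]
    exact sum_eq_zero fun w _ => sum_eq_zero fun v _ => if_neg fun h => hτ h.1

/-- The parameter `m` varies because each peeled entry or descent pair becomes a remaining tree
step. -/
theorem avoidingWeight_eq (n : ℕ) (S : Finset ℕ) (m : ℕ) (hS : S ⊆ Icc 1 (n - 1))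
    (hcons : ∀ i ∈ S, i + 1 ∉ S) : avoidingWeight n S m = catalan (m + n - S.card) := by
  induction n using Nat.strong_induction_on generalizing S m with
  | _ n ih =>
  rcases n with _ | n
  · obtain rfl : S = ∅ := by simpa using hS
    simp [avoidingWeight, Avoids321, catalanTreeCount_zero_right]
  · by_cases hn : n ∈ S
    · obtain ⟨k, rfl⟩ : ∃ k, n = k + 1 :=
        ⟨n - 1, by have := mem_Icc.1 (hS hn); omega⟩
      have hk : k ∉ S := fun h => hcons k h hn
      have hE : S.erase (k + 1) ⊆ Icc 1 (k - 1) := fun i hi => by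
        rw [mem_erase] at hi
        have h1 := mem_Icc.1 (hS hi.2)
        have h2 : i ≠ k := fun h => hk (h ▸ hi.2)
        rw [mem_Icc]
        omega
      have hc := card_le_card hE
      have hc' := card_erase_add_one hn
      rw [Nat.card_Icc] at hc
      conv_lhs => rw [← insert_erase hn]
      rw [avoidingWeight_insert hE, ih k (by omega) _ _ hE fun i hi h =>
        hcons i (mem_of_mem_erase hi) (mem_of_mem_erase h)]
      congr 1
      omega
    · have hS' : S ⊆ Icc 1 (n - 1) := fun i hi => by
        have h1 := mem_Icc.1 (hS hi)
        have h2 : i ≠ n := fun h => hn (h ▸ hi)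
        rw [mem_Icc]
        omega
      rw [avoidingWeight_succ hS', ih n (by omega) _ _ hS' hcons]
      congr 1
      omega

theorem not_avoids321_of_consecutive_descents {n i : ℕ} {π : Equiv.Perm (Fin n)}
    (h : i ∈ descentSet π) (h' : i + 1 ∈ descentSet π) : ¬ Avoids321 π := by
  obtain ⟨hi, hd⟩ := h
  obtain ⟨hi', hd'⟩ := h'
  refine not_not.2 ⟨⟨i - 1, by omega⟩, ⟨i, hi.2⟩, ⟨i + 1, hi'.2⟩, ?_, ?_, hd, hd'⟩
  · simp only [Fin.mk_lt_mk]
    omega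
  · simp

theorem mainTheorem7 (n : ℕ) (S : Finset ℕ) (hS : S ⊆ Finset.Icc 1 (n - 1)) :
    ((∀ i ∈ S, i + 1 ∉ S) →
      {π : Equiv.Perm (Fin n) | Avoids321 π ∧ (S : Set ℕ) ⊆ descentSet π}.ncard =
        catalan (n - S.card)) ∧
    (¬ (∀ i ∈ S, i + 1 ∉ S) →
      {π : Equiv.Perm (Fin n) | Avoids321 π ∧ (S : Set ℕ) ⊆ descentSet π}.ncard = 0) := by
  classical
  constructor
  · intro hcons
    -- With no steps remaining every weight is `1`, so the weighted sum is the cardinality.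
    have h := avoidingWeight_eq n S 0 hS hcons
    rw [zero_add] at h
    rw [← h, Set.ncard_eq_toFinset_card', Set.toFinset_ofPred, card_filter, avoidingWeight]
    exact sum_congr rfl fun π _ => by simp only [catalanTreeCount]
  · intro hcons
    push Not at hcons
    obtain ⟨i, hi, hi'⟩ := hcons
    rw [Set.ncard_eq_zero]
    exact Set.eq_empty_of_forall_notMem fun π hπ =>
      not_avoids321_of_consecutive_descents (hπ.2 hi) (hπ.2 hi') hπ.1
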